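/- For a bounded sequence $\alpha=(\alpha_0,\alpha_1,\dots)$ of positive numbers let $W_\alpha$ be the unilateral weighted shift on $\ell^2(\mathbb{Z}_+)$, $W_\alpha e_n=\alpha_n e_{n+1}$. A tuple of bounded operators on a complex Hilbert space is *normal* if its entries commute and are normal; it is *(jointly) subnormal* if it is the restriction of a normal tuple on a larger Hilbert space to a common invariant subspace; a tuple $(T_1,\dots,T_n)$ on $\mathcal H$ is *(jointly) hyponormal* if the operator matrix with $(i,j)$ entry $[T_j^*,T_i]=T_j^*T_i-T_iT_j^*$ is positive on the direct sum of $n$ copies of $\mathcal H$. The *Berger measure* of a subnormal shift $W_\alpha$ is the unique probability measure $\mu$ supported in $[0,\|W_\alpha\|^2]$ with $\alpha_0^2\cdots\alpha_{k-1}^2=\int t^k\,d\mu(t)$ for all $k\ge 0$. For a probability measure $\mu$ on $[0,\infty)$ put $\mathrm{ext}(\mu):=\left(\int \frac1t\,d\mu(t)\right)^{-1/2}$, which is $0$ if $\frac1t\notin L^1(\mu)$. **Theorem.** Let $\{\xi_k\}_{k\ge0}$ and $\{\eta_k\}_{k\ge0}$ be strictly increasing bounded sequences of positive numbers such that $W_\xi$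 and $W_\eta$ are subnormal. Let $\nu_{\mathcal M}$ and $\omega_{\mathcal M}$ be the Berger measures of the restrictions of $W_\xi$ and $W_\eta$ to the closed span $\mathcal M$ of $e_1,e_2,\dots$, i.e. of the shifts with weights $\xi_1,\xi_2,\dots$ and $\eta_1,\eta_2,\dots$. Let $0<a,b<1$ with $a\eta_0=b\xi_0$, and let $\mathbf T=(T_1,T_2)$ be the $2$-variable weighted shift on $\ell^2(\mathbb{Z}_+^2)$, $$T_1e_{(k_1,k_2)}=\alpha(k_1,k_2)\,e_{(k_1+1,k_2)},\qquad T_2e_{(k_1,k_2)}=\beta(k_1,k_2)\,e_{(k_1,k_2+1)},$$ where $\alpha(0,0)=a$, $\beta(0,0)=b$, and $\alpha(k_1,k_2)=\xi_{k_1}$, $\beta(k_1,k_2)=\eta_{k_2}$ if $(k_1,k_2)\ne(0,0)$. Put $$h:=\xi_0\sqrt{\frac{\xi_1^2\eta_1^2-\xi_0^2\eta_0^2}{\xi_0^2\eta_1^2+\xi_1^2\eta_0^2-2\xi_0^2\eta_0^2}},\qquad s:=\sqrt{\frac{\xi_0^2\xi_1^2\eta_1^2}{\xi_1^2\eta_0^2+\xi_0^2\eta_1^2-\xi_0^2\eta_0^2}},$$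 $$\eta_e:=\mathrm{ext}(\omega_{\mathcal M}),\qquad s_2:=\frac{\xi_0}{\eta_0}\eta_e,\qquad u:=\frac{\xi_0^2\eta_e^2\eta_1^2}{\xi_1^2(\eta_1^2-\eta_e^2)+\xi_0^2\eta_e^2},$$ $$v:=\frac{\xi_1^2(\eta_1^2-\eta_e^2)+2\xi_0^2\eta_e^2-\sqrt{(\eta_1^2-\eta_e^2)\left(\xi_1^4(\eta_1^2-\eta_e^2)+4\xi_0^2\eta_e^2(\xi_1^2-\xi_0^2)\right)}}{2\xi_0^2}.$$ Assume that $s_2=\mathrm{ext}(\nu_{\mathcal M})$, that $\eta_0\le\min\{u,v\}$, and that $s<a\le h$. Then 1. $T_1T_2=T_2T_1$; 2. $T_1$ is subnormal; 3. $T_2$ is subnormal; 4. $\mathbf T$ is hyponormal; 5. $\mathbf T$ is not subnormal. -/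

import Mathlib

noncomputable section

/-- The function `m ↦ w k * x k` if `m = k + ε`, and `0` if `m` is not of the form `k + ε`. -/
def shiftFun {I : Type*} [AddCancelCommMonoid I] (ε : I) (w : I → ℝ) (x : I → ℂ) : I → ℂ :=
  Function.extend (fun k : I => k + ε) (fun k => (w k : ℂ) * x k) 0

theorem shiftFun_norm_sq {I : Type*} [AddCancelCommMonoid I] (ε : I) (w : I → ℝ) (x : I → ℂ) :
    (fun m => ‖shiftFun ε w x m‖ ^ (2 : ℝ)) =
      Function.extend (fun k : I => k + ε) (fun k => ‖(w k : ℂ) * x k‖ ^ (2 : ℝ)) 0 := by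
  funext m
  by_cases hm : ∃ k, k + ε = m
  · obtain ⟨k, rfl⟩ := hm
    have hinj : Function.Injective (fun k : I => k + ε) := add_left_injective ε
    have h1 := hinj.extend_apply (fun k => (w k : ℂ) * x k) 0 k
    have h2 := hinj.extend_apply (fun k => ‖(w k : ℂ) * x k‖ ^ (2 : ℝ)) 0 k
    simp only [shiftFun] at *
    rw [h1, h2]
  · rw [Function.extend_apply' _ _ _ hm, shiftFun, Function.extend_apply' _ _ _ hm]
    simp

theorem shiftFun_le {w : ℝ} {C : ℝ} (z : ℂ) (hw : |w| ≤ C) :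
    ‖(w : ℂ) * z‖ ^ (2 : ℝ) ≤ C ^ (2 : ℝ) * ‖z‖ ^ (2 : ℝ) := by
  rw [norm_mul, Complex.norm_real, Real.norm_eq_abs,
    Real.mul_rpow (abs_nonneg _) (norm_nonneg _)]
  gcongr

theorem lp_two_summable {I : Type*} (x : lp (fun _ : I => ℂ) 2) :
    Summable fun k => ‖x k‖ ^ (2 : ℝ) := by
  simpa using (lp.memℓp x).summable (by norm_num)

theorem shiftFun_summable {I : Type*} (w : I → ℝ) {C : ℝ}
    (hw : ∀ k, |w k| ≤ C) (x : lp (fun _ : I => ℂ) 2) :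
    Summable fun k => ‖(w k : ℂ) * x k‖ ^ (2 : ℝ) :=
  Summable.of_nonneg_of_le (fun _ => by positivity) (fun k => shiftFun_le (x k) (hw k))
    ((lp_two_summable x).mul_left _)

theorem shiftFun_mem {I : Type*} [AddCancelCommMonoid I] (ε : I) (w : I → ℝ) {C : ℝ}
    (hw : ∀ k, |w k| ≤ C) (x : lp (fun _ : I => ℂ) 2) :
    Memℓp (E := fun _ : I => ℂ) (shiftFun ε w x) 2 := by
  apply memℓp_gen
  have h : Summable fun m => ‖shiftFun ε w x m‖ ^ (2 : ℝ) := by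
    rw [shiftFun_norm_sq]
    exact (summable_extend_zero (add_left_injective ε)).2 (shiftFun_summable w hw x)
  simpa using h

/-- The bounded operator on `ℓ²(I)` with `e_k ↦ w k • e_(k+ε)`, for weights bounded by `C`. -/
def weightedShiftOfBound {I : Type*} [AddCancelCommMonoid I] (ε : I) (w : I → ℝ) (C : ℝ)
    (hw : ∀ k, |w k| ≤ C) : lp (fun _ : I => ℂ) 2 →L[ℂ] lp (fun _ : I => ℂ) 2 :=
  LinearMap.mkContinuous
    { toFun := fun x => ⟨shiftFun ε w x, shiftFun_mem ε w hw x⟩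
      map_add' := by
        intro x y
        ext m
        simp only [lp.coeFn_add, Pi.add_apply]
        by_cases hm : ∃ k, k + ε = m
        · obtain ⟨k, rfl⟩ := hm
          have hinj : Function.Injective (fun k : I => k + ε) := add_left_injective ε
          have h (z : I → ℂ) := hinj.extend_apply (fun k => (w k : ℂ) * z k) 0 k
          simp only [shiftFun, h, Pi.add_apply]
          ring
        · simp [shiftFun, Function.extend_apply' _ _ _ hm]
      map_smul' := by
        intro c x
        ext m
        simp only [lp.coeFn_smul, Pi.smul_apply, RingHom.id_apply, smul_eq_mul]
        by_cases hm : ∃ k, k + ε = m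
        · obtain ⟨k, rfl⟩ := hm
          have hinj : Function.Injective (fun k : I => k + ε) := add_left_injective ε
          have h (z : I → ℂ) := hinj.extend_apply (fun k => (w k : ℂ) * z k) 0 k
          simp only [shiftFun, h, Pi.smul_apply, smul_eq_mul]
          ring
        · simp [shiftFun, Function.extend_apply' _ _ _ hm] }
    |C| (by
      intro x
      refine lp.norm_le_of_tsum_le (by norm_num) (by positivity) ?_
      have h2 : (2 : ENNReal).toReal = (2 : ℝ) := by norm_num
      rw [h2]
      change ∑' m, ‖shiftFun ε w x m‖ ^ (2 : ℝ) ≤ _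
      rw [shiftFun_norm_sq, tsum_extend_zero (add_left_injective ε),
        Real.mul_rpow (abs_nonneg _) (norm_nonneg _)]
      have hx := lp.norm_rpow_eq_tsum (p := 2) (by norm_num) x
      rw [h2] at hx
      rw [hx, ← tsum_mul_left]
      exact Summable.tsum_le_tsum
        (fun k => shiftFun_le (x k) ((hw k).trans (le_abs_self C)))
        (shiftFun_summable w hw x) ((lp_two_summable x).mul_left _))

open Classical in
/-- The weighted shift on `ℓ²(I)` in direction `ε` with the bounded weights `w`, that is
the bounded operator with `e_k ↦ w k • e_(k+ε)`
(by convention it is `0` when the weights are unbounded). -/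
def weightedShift {I : Type*} [AddCancelCommMonoid I] (ε : I) (w : I → ℝ) :
    lp (fun _ : I => ℂ) 2 →L[ℂ] lp (fun _ : I => ℂ) 2 :=
  if h : ∃ C, ∀ k, |w k| ≤ C then weightedShiftOfBound ε w h.choose h.choose_spec else 0

/-- The defining property of the weighted shift on the canonical orthonormal basis. -/
theorem weightedShift_single {I : Type*} [AddCancelCommMonoid I] [DecidableEq I] (ε : I)
    (w : I → ℝ) (hw : ∃ C, ∀ k, |w k| ≤ C) (k : I) :
    weightedShift ε w (lp.single 2 k (1 : ℂ)) = (w k : ℂ) • lp.single 2 (k + ε) (1 : ℂ) := by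
  rw [weightedShift, dif_pos hw]
  ext m
  rw [lp.coeFn_smul, Pi.smul_apply, lp.single_apply]
  change shiftFun ε w (lp.single 2 k (1 : ℂ) : I → ℂ) m = _
  by_cases hm : ∃ j, j + ε = m
  · obtain ⟨j, rfl⟩ := hm
    have hinj : Function.Injective (fun k : I => k + ε) := add_left_injective ε
    have h (z : I → ℂ) := hinj.extend_apply (fun k => (w k : ℂ) * z k) 0 j
    simp only [shiftFun, h]
    by_cases hjk : j = k
    · subst hjk; simp
    · have : j + ε ≠ k + ε := fun h => hjk (add_right_cancel h)
      simp [Pi.single_eq_of_ne hjk, Pi.single_eq_of_ne this]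
  · have hmk : m ≠ k + ε := fun h => hm ⟨k, h.symm⟩
    simp [shiftFun, Function.extend_apply' _ _ _ hm, Pi.single_eq_of_ne hmk]

/-- The unilateral weighted shift `W_α` on `ℓ²(ℤ₊)`: `e_n ↦ α n • e_(n+1)`. -/
def unilateralShift (α : ℕ → ℝ) : lp (fun _ : ℕ => ℂ) 2 →L[ℂ] lp (fun _ : ℕ => ℂ) 2 :=
  weightedShift 1 α

/-- The 2-variable weighted shift `(T₁, T₂)` on `ℓ²(ℤ₊²)`:
`T₁ e_k = α k • e_(k+(1,0))` and `T₂ e_k = β k • e_(k+(0,1))`. -/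
def twoVarShift (α β : ℕ × ℕ → ℝ) :
    Fin 2 → (lp (fun _ : ℕ × ℕ => ℂ) 2 →L[ℂ] lp (fun _ : ℕ × ℕ => ℂ) 2) :=
  ![weightedShift ((1, 0) : ℕ × ℕ) α, weightedShift ((0, 1) : ℕ × ℕ) β]

/-- A tuple of bounded operators is normal if it is commuting and each entry is normal. -/
def IsNormalTuple {n : ℕ} {K : Type*} [NormedAddCommGroup K] [InnerProductSpace ℂ K]
    [CompleteSpace K] (N : Fin n → K →L[ℂ] K) : Prop :=
  (∀ i j, N i * N j = N j * N i) ∧ ∀ i, IsStarNormal (N i)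

/-- A tuple of bounded operators on `H` is (jointly) subnormal if, for some Hilbert space `K`
containing `H` (through a linear isometry `J`), it is the restriction to `H` of a normal tuple
on `K` that leaves `H` invariant. -/
def IsSubnormalTuple.{u} {n : ℕ} {H : Type u} [NormedAddCommGroup H] [InnerProductSpace ℂ H]
    [CompleteSpace H] (T : Fin n → H →L[ℂ] H) : Prop :=
  ∃ (K : Type u) (_ : NormedAddCommGroup K) (_ : InnerProductSpace ℂ K) (_ : CompleteSpace K)
    (J : H →ₗᵢ[ℂ] K) (N : Fin n → K →L[ℂ] K),
    IsNormalTuple N ∧ ∀ i x, N i (J x) = J (T i x)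

/-- A single bounded operator is subnormal if it is the restriction of a normal operator to an
invariant subspace. -/
def IsSubnormalOp {H : Type*} [NormedAddCommGroup H] [InnerProductSpace ℂ H]
    [CompleteSpace H] (T : H →L[ℂ] H) : Prop :=
  IsSubnormalTuple ![T]

/-- A tuple `T` is (jointly) hyponormal if the operator matrix whose `(i, j)` entry is the
commutator `[T_j^*, T_i]` is positive on the direct sum of `n` copies of `H`.  (This operator
matrix is self-adjoint, so its quadratic form is real.) -/
def IsHyponormalTuple {n : ℕ} {H : Type*} [NormedAddCommGroup H] [InnerProductSpace ℂ H]
    [CompleteSpace H] (T : Fin n → H →L[ℂ] H) : Prop :=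
  ∀ x : Fin n → H,
    0 ≤ (∑ i, inner ℂ (x i) (∑ j, (star (T j) * T i - T i * star (T j)) (x j))).re

/-- `μ` is the Berger measure of the unilateral weighted shift `W_α`: a probability measure
supported in `[0, ‖W_α‖²]` whose moments are those of `α`. -/
def IsBergerMeasure (α : ℕ → ℝ) (μ : MeasureTheory.Measure ℝ) : Prop :=
  MeasureTheory.IsProbabilityMeasure μ ∧
    μ (Set.Icc 0 (‖unilateralShift α‖ ^ 2))ᶜ = 0 ∧
    ∀ k : ℕ, ∏ i ∈ Finset.range k, α i ^ 2 = ∫ t, t ^ k ∂μ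

/-- The extremal value `(‖1/t‖_{L¹(μ)})^(-1/2)`, which is `0` if `1/t` is not in `L¹(μ)`.
Here `1/t = ∞` at `t = 0`, so an atom at `0` makes the value `0`. -/
def extremalValue (μ : MeasureTheory.Measure ℝ) : ℝ :=
  Real.sqrt ((∫⁻ t, (ENNReal.ofReal t)⁻¹ ∂μ)⁻¹).toReal

/-- The weights `α(k)`: `a` at the origin and `ξ_(k₁)` elsewhere. -/
def alphaWeights (ξ : ℕ → ℝ) (a : ℝ) (k : ℕ × ℕ) : ℝ :=
  if k = (0, 0) then a else ξ k.1

/-- The weights `β(k)`: `b` at the origin and `η_(k₂)` elsewhere. -/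
def betaWeights (η : ℕ → ℝ) (b : ℝ) (k : ℕ × ℕ) : ℝ :=
  if k = (0, 0) then b else η k.2

end

noncomputable section

/-! Three thresholds for `a` decide everything, with `b` tied to `a` by `a * η 0 = b * ξ 0`.

Joint subnormality forces `a ≤ s`. For a normal extension `(A, B)`, the commuting positive operators
`P = A*A`, `Q = B*B` satisfy `‖(P - p)(Q - q) e‖² ≥ 0`, which is an inequality between moments of
`T` at `e`. At the vacuum vector with `p = ξ 1 ^ 2`, `q = η 1 ^ 2` it reads `a ≤ s`
(`IsSubnormalTuple.moment_nonneg`, `IsSubnormalTuple.le_of_alphaWeights_betaWeights`).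

Joint hyponormality follows from positivity of a 2-by-2 matrix at each lattice point
(`isHyponormalTuple_twoVarShift`). Only the origin matters here, and its determinant condition is `a
≤ h`.

Each `T i` is a direct sum of one-variable shifts, all backward extensions of the same shift. By
Curto's criterion such an extension by a weight `c` is subnormal when `c` is at most the extremal
value: its measure is `(c² / t) dμ` plus the missing mass at `0`. A multiplication operator on one
`L²` space extends all summands at once (`exists_normal_of_moments`). The weights `a` and `b` obey
these bounds because `v` is the smaller root of the quadratic expressing `h ≤ s₂`. -/

theorem IsSubnormalOp.of_orthonormal {I : Type} [AddCancelCommMonoid I] (ε : I) (w : I → ℝ)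
    (hw : ∃ C, ∀ k, |w k| ≤ C) {K : Type} [NormedAddCommGroup K] [InnerProductSpace ℂ K]
    [CompleteSpace K] (N : K →L[ℂ] K) (hN : IsStarNormal N) (v : I → K) (hv : Orthonormal ℂ v)
    (hNv : ∀ k, N (v k) = (w k : ℂ) • v (k + ε)) : IsSubnormalOp (weightedShift ε w) := by
  classical
  let J := hv.orthogonalFamily.linearIsometry
  have hJ (k : I) : J (lp.single 2 k (1 : ℂ)) = v k := by
    rw [hv.orthogonalFamily.linearIsometry_apply_single]
    simp [LinearIsometry.toSpanSingleton_apply]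
  have key : N.comp J.toContinuousLinearMap =
      J.toContinuousLinearMap.comp (weightedShift ε w) := by
    apply lp.ext_continuousLinearMap (by norm_num)
    intro k
    ext
    change N (J (lp.single 2 k (1 : ℂ))) = J (weightedShift ε w (lp.single 2 k (1 : ℂ)))
    rw [weightedShift_single ε w hw, map_smul, hJ, hJ, hNv]
  refine ⟨K, inferInstance, inferInstance, inferInstance, J, ![N], ⟨?_, ?_⟩, ?_⟩
  · intro i j
    rw [Subsingleton.elim i j]
  · intro i
    simpa using hN
  · intro i x
    simpa using DFunLike.congr_fun key x

/-! ### Moment inequalities for subnormal pairs. -/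

theorem Commute.star_mul_self_pow {R : Type*} [Semiring R] [StarRing R] {A B : R}
    (hA : Commute (star A) A) (hB : Commute (star B) B) (hAB : Commute (star A * A) (star B))
    (i j : ℕ) :
    star (A ^ i * B ^ j) * (A ^ i * B ^ j) = (star A * A) ^ i * (star B * B) ^ j := by
  rw [star_mul, star_pow, star_pow]
  calc _ = star B ^ j * (star A ^ i * A ^ i) * B ^ j := by simp only [mul_assoc]
    _ = _ := by
      rw [← hA.mul_pow, ← (hAB.pow_pow i j).eq, mul_assoc, ← hB.mul_pow]

/-- For a subnormal pair `T`, the moments `‖T₁ⁱ T₂ʲ e‖²` are nonnegative on squares of products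
of monic linear polynomials. -/
theorem IsSubnormalTuple.moment_nonneg {H : Type*} [NormedAddCommGroup H] [InnerProductSpace ℂ H]
    [CompleteSpace H] {T : Fin 2 → H →L[ℂ] H} (hT : IsSubnormalTuple T) (e : H) (p q : ℝ) :
    0 ≤ (‖(T 0 ^ 2) ((T 1 ^ 2) e)‖ ^ 2 - 2 * q * ‖(T 0 ^ 2) (T 1 e)‖ ^ 2
        + q ^ 2 * ‖(T 0 ^ 2) e‖ ^ 2)
      - 2 * p * (‖T 0 ((T 1 ^ 2) e)‖ ^ 2 - 2 * q * ‖T 0 (T 1 e)‖ ^ 2 + q ^ 2 * ‖T 0 e‖ ^ 2)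
      + p ^ 2 * (‖(T 1 ^ 2) e‖ ^ 2 - 2 * q * ‖T 1 e‖ ^ 2 + q ^ 2 * ‖e‖ ^ 2) := by
  obtain ⟨K, _, _, _, J, N, ⟨hcomm, hnor⟩, hJ⟩ := hT
  set A := N 0 with hA
  set B := N 1 with hB
  have hA' : IsStarNormal A := hnor 0
  have hB' : IsStarNormal B := hnor 1
  have hAB : Commute A B := hcomm 0 1
  have h1 : Commute A (star B) := hB'.commute_star_right hAB
  have h2 : Commute (star A) B := hA'.commute_star_left hAB
  have h3 : Commute (star A) (star B) := hB'.commute_star_right h2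
  have hAA : Commute (star A) A := hA'.star_comm_self
  have hBB : Commute (star B) B := hB'.star_comm_self
  have hJn (x : H) (i : Fin 2) (n : ℕ) : J ((T i ^ n) x) = (N i ^ n) (J x) := by
    induction n generalizing x with
    | zero => simp
    | succ n ih =>
      rw [pow_succ, pow_succ]
      change J ((T i ^ n) (T i x)) = (N i ^ n) (N i (J x))
      rw [ih, hJ]
  have hcomm' (i j : ℕ) : J ((T 0 ^ i) ((T 1 ^ j) e)) = (A ^ i * B ^ j) (J e) := by
    rw [hJn, hJn]
    rfl
  set f := J e with hf
  set P := star A * A with hP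
  set Q := star B * B with hQ
  have hPB : Commute P (star B) := h3.mul_left h1
  have hPQ : Commute P Q := hPB.mul_right (h2.mul_left hAB)
  let φ : (K →L[ℂ] K) → ℝ := fun X => (inner ℂ f (X f)).re
  have hφ (Z : K →L[ℂ] K) : φ (star Z * Z) = ‖Z f‖ ^ 2 := by
    change (inner ℂ f (ContinuousLinearMap.adjoint Z (Z f))).re = _
    rw [ContinuousLinearMap.adjoint_inner_right, inner_self_eq_norm_sq_to_K]
    norm_cast
  have hφm (i j : ℕ) : φ (P ^ i * Q ^ j) = ‖(T 0 ^ i) ((T 1 ^ j) e)‖ ^ 2 := by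
    rw [← J.norm_map ((T 0 ^ i) ((T 1 ^ j) e)), hcomm', ← hφ,
      Commute.star_mul_self_pow hAA hBB hPB]
  have hφadd (X Y : K →L[ℂ] K) : φ (X + Y) = φ X + φ Y := by
    simp [φ]
  have hφsmul (r : ℝ) (X : K →L[ℂ] K) : φ ((r : ℂ) • X) = r * φ X := by
    simp [φ]
  -- `Z = (P - p)(Q - q)` is self-adjoint because `P` and `Q` commute. Hence `φ (star Z * Z)` is a
  -- square, and it expands into the moments `φ (P ^ i * Q ^ j)` with `i, j ≤ 2`.
  let Z := (P + ((-p : ℝ) : ℂ) • 1) * (Q + ((-q : ℝ) : ℂ) • 1)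
  have hZ : star Z * Z = P ^ 2 * Q ^ 2 + ((-2 * q : ℝ) : ℂ) • (P ^ 2 * Q ^ 1)
      + ((q ^ 2 : ℝ) : ℂ) • (P ^ 2 * Q ^ 0)
      + ((-2 * p : ℝ) : ℂ) • (P ^ 1 * Q ^ 2) + ((4 * p * q : ℝ) : ℂ) • (P ^ 1 * Q ^ 1)
      + ((-2 * p * q ^ 2 : ℝ) : ℂ) • (P ^ 1 * Q ^ 0)
      + ((p ^ 2 : ℝ) : ℂ) • (P ^ 0 * Q ^ 2) + ((-2 * p ^ 2 * q : ℝ) : ℂ) • (P ^ 0 * Q ^ 1)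
      + ((p ^ 2 * q ^ 2 : ℝ) : ℂ) • (P ^ 0 * Q ^ 0) := by
    have hc : Commute (P + ((-p : ℝ) : ℂ) • 1) (Q + ((-q : ℝ) : ℂ) • 1) := by
      refine (hPQ.add_right ?_).add_left (Commute.add_right ?_ ?_)
      · exact (Commute.one_right P).smul_right _
      · exact (Commute.one_left Q).smul_left _
      · exact ((Commute.one_right _).smul_right _)
    have hs : star Z = Z := by
      simp only [Z, star_mul, star_add, star_smul, star_one, hP, hQ, star_star,
        Complex.star_def, Complex.conj_ofReal]
      exact hc.eq.symm
    rw [hs]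
    have hQP : Q * P = P * Q := hPQ.eq.symm
    have e1 : Z * Z = (P + ((-p : ℝ) : ℂ) • 1) ^ 2 * (Q + ((-q : ℝ) : ℂ) • 1) ^ 2 := by
      rw [← hc.mul_pow, pow_two]
    rw [e1]
    have e2 (X : K →L[ℂ] K) (r : ℝ) :
        (X + ((-r : ℝ) : ℂ) • 1) ^ 2 = X ^ 2 + ((-2 * r : ℝ) : ℂ) • X ^ 1
          + ((r ^ 2 : ℝ) : ℂ) • X ^ 0 := by
      rw [pow_two, add_mul, mul_add, mul_add, pow_two, pow_one, pow_zero, smul_one_mul, smul_one_mul,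
        mul_smul_one]
      push_cast
      module
    rw [e2, e2]
    simp only [add_mul, mul_add, smul_mul_assoc, mul_smul_comm]
    push_cast
    module
  have h0 : 0 ≤ φ (star Z * Z) := by
    rw [hφ]
    positivity
  rw [hZ] at h0
  simp only [hφadd, hφsmul, hφm] at h0
  simp only [pow_zero, pow_one, one_apply_eq_self] at h0
  linarith

/-! ### Multiplication operators and a normal model for direct sums of shifts. -/

open MeasureTheory in
/-- Multiplication on `L²` by an essentially bounded function. -/
def mulLpTop {X : Type*} [MeasurableSpace X] {μ : Measure X} (φ : X → ℂ) (hφ : MemLp φ ⊤ μ) :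
    Lp ℂ 2 μ →L[ℂ] Lp ℂ 2 μ :=
  (ContinuousLinearMap.mul ℂ ℂ).holderL μ ⊤ 2 2 (hφ.toLp φ)

open MeasureTheory in
theorem coeFn_mulLpTop {X : Type*} [MeasurableSpace X] {μ : Measure X} (φ : X → ℂ)
    (hφ : MemLp φ ⊤ μ) (f : Lp ℂ 2 μ) : mulLpTop φ hφ f =ᵐ[μ] fun x => φ x * f x := by
  have h := (ContinuousLinearMap.mul ℂ ℂ).coeFn_holder (r := 2) (hφ.toLp φ) f
  filter_upwards [h, hφ.coeFn_toLp] with x h1 h2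
  rw [← h2]
  exact h1

open MeasureTheory in
theorem adjoint_mulLpTop {X : Type*} [MeasurableSpace X] {μ : Measure X} (φ : X → ℂ)
    (hφ : MemLp φ ⊤ μ) : star (mulLpTop φ hφ) = mulLpTop (star φ) hφ.star := by
  symm
  rw [ContinuousLinearMap.star_eq_adjoint, ContinuousLinearMap.eq_adjoint_iff]
  intro f g
  rw [L2.inner_def, L2.inner_def]
  apply integral_congr_ae
  filter_upwards [coeFn_mulLpTop φ hφ g, coeFn_mulLpTop (star φ) hφ.star f] with x h1 h2
  rw [h1, h2]
  simp
  ring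

open MeasureTheory in
theorem isStarNormal_mulLpTop {X : Type*} [MeasurableSpace X] {μ : Measure X} (φ : X → ℂ)
    (hφ : MemLp φ ⊤ μ) : IsStarNormal (mulLpTop φ hφ) := by
  constructor
  rw [adjoint_mulLpTop]
  ext f
  change ⇑(mulLpTop (star φ) hφ.star (mulLpTop φ hφ f)) =ᵐ[μ]
    ⇑(mulLpTop φ hφ (mulLpTop (star φ) hφ.star f))
  filter_upwards [coeFn_mulLpTop φ hφ f, coeFn_mulLpTop (star φ) hφ.star f,
    coeFn_mulLpTop φ hφ (mulLpTop (star φ) hφ.star f),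
    coeFn_mulLpTop (star φ) hφ.star (mulLpTop φ hφ f)] with x h1 h2 h3 h4
  rw [h3, h4, h1, h2]
  ring

theorem integral_conj_fourier_mul_fourier (m n : ℤ) :
    ∫ z : UnitAddCircle, (starRingEnd ℂ) (fourier m z) * fourier n z ∂AddCircle.haarAddCircle =
      if m = n then 1 else 0 := by
  have h := orthonormal_iff_ite.1 (orthonormal_fourier (T := 1)) m n
  rw [MeasureTheory.ContinuousMap.inner_toLp] at h
  rw [← h]
  congr 1 with z
  ring

open MeasureTheory in
/-- A normal operator which acts on an orthonormal family indexed by `ℕ × ℕ` as the direct sum of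
weighted shifts whose moments are those of the measures `q_j² dσ`. -/
theorem exists_normal_of_moments (σ : Measure ℝ) [IsFiniteMeasure σ] (M : ℝ)
    (hσ : ∀ᵐ t ∂σ, t ∈ Set.Icc 0 M) (w : ℕ → ℕ → ℝ) (hw : ∀ j i, 0 < w j i) (q : ℕ → ℝ → ℝ)
    (hq : ∀ j, Measurable (q j)) (hint : ∀ j i, Integrable (fun t => t ^ i * q j t ^ 2) σ)
    (hmom : ∀ j i, ∫ t, t ^ i * q j t ^ 2 ∂σ = ∏ m ∈ Finset.range i, w j m ^ 2) :
    ∃ (K : Type) (_ : NormedAddCommGroup K) (_ : InnerProductSpace ℂ K) (_ : CompleteSpace K)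
      (N : K →L[ℂ] K) (v : ℕ × ℕ → K), IsStarNormal N ∧ Orthonormal ℂ v ∧
        ∀ i j, N (v (i, j)) = (w j i : ℂ) • v (i + 1, j) := by
  let ρ : Measure UnitAddCircle := AddCircle.haarAddCircle
  let μ : Measure (ℝ × UnitAddCircle × UnitAddCircle) := σ.prod (ρ.prod ρ)
  have hμ : ∀ᵐ x ∂μ, x.1 ∈ Set.Icc 0 M := Measure.quasiMeasurePreserving_fst.ae hσ
  -- The symbol is `√t · z` in polar form, so `|φ|² = t` almost everywhere and the moments of `σ`
  -- become squared norms.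
  let φ : ℝ × UnitAddCircle × UnitAddCircle → ℂ := fun x => (√x.1 : ℂ) * fourier 1 x.2.1
  have hφ : MemLp φ ⊤ μ := by
    refine memLp_top_of_bound (by fun_prop) √M ?_
    filter_upwards [hμ] with x hx
    simp only [φ, norm_mul, fourier_apply, Circle.norm_coe, mul_one, Complex.norm_real,
      Real.norm_eq_abs, abs_of_nonneg (Real.sqrt_nonneg _)]
    exact Real.sqrt_le_sqrt hx.2
  let c : ℕ × ℕ → ℝ := fun k => ∏ m ∈ Finset.range k.1, w k.2 m
  have hc (k) : 0 < c k := Finset.prod_pos fun m _ => hw _ _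
  let g : ℕ × ℕ → ℝ → ℝ := fun k t => √t ^ k.1 * q k.2 t / c k
  have hg (k) : Measurable (g k) := by
    have := hq k.2
    fun_prop
  -- The radial factors `g k` are unit vectors but need not be orthogonal. The character on the
  -- first circle separates positions within one summand, the one on the second circle separates
  -- summands. The symbol raises only the first character.
  let V : ℕ × ℕ → ℝ × UnitAddCircle × UnitAddCircle → ℂ := fun k x =>
    (g k x.1 : ℂ) * (fourier k.1 x.2.1 * fourier k.2 x.2.2)
  have hgsq (k) : (fun t => g k t ^ 2) =ᵐ[σ] fun t => t ^ k.1 * q k.2 t ^ 2 / c k ^ 2 := by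
    filter_upwards [hσ] with t ht
    simp only [g, div_pow, mul_pow, ← pow_mul, mul_comm k.1 2]
    rw [pow_mul, Real.sq_sqrt ht.1]
  have hgint (k) : ∫ t, g k t ^ 2 ∂σ = 1 := by
    rw [integral_congr_ae (hgsq k), integral_div, hmom, Finset.prod_pow]
    exact div_self (pow_ne_zero 2 (hc k).ne')
  have hV (k) : MemLp (V k) 2 μ := by
    rw [memLp_two_iff_integrable_sq_norm (by fun_prop)]
    have h1 : Integrable (fun t => g k t ^ 2) σ :=
      ((hint k.2 k.1).div_const _).congr (hgsq k).symm
    refine (h1.comp_fst (ρ.prod ρ)).congr (.of_forall fun x => ?_)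
    simp [V, fourier_apply, Circle.norm_coe]
  refine ⟨Lp ℂ 2 μ, inferInstance, inferInstance, inferInstance, mulLpTop φ hφ,
    fun k => (hV k).toLp (V k), isStarNormal_mulLpTop φ hφ, ?_, ?_⟩
  · rw [orthonormal_iff_ite]
    intro k l
    rw [L2.inner_def]
    have h1 : ∀ᵐ x ∂μ, inner ℂ ((hV k).toLp (V k) x) ((hV l).toLp (V l) x) =
        (g k x.1 * g l x.1 : ℂ) *
          (((starRingEnd ℂ) (fourier k.1 x.2.1) * fourier l.1 x.2.1) *
            ((starRingEnd ℂ) (fourier k.2 x.2.2) * fourier l.2 x.2.2)) := by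
      filter_upwards [(hV k).coeFn_toLp, (hV l).coeFn_toLp] with x hk hl
      rw [hk, hl]
      simp only [V, RCLike.inner_apply, map_mul, Complex.conj_ofReal]
      ring
    rw [integral_congr_ae h1, integral_prod_mul (fun t => (g k t * g l t : ℂ))
      (fun z : UnitAddCircle × UnitAddCircle =>
        ((starRingEnd ℂ) (fourier k.1 z.1) * fourier l.1 z.1) *
            ((starRingEnd ℂ) (fourier k.2 z.2) * fourier l.2 z.2)),
      integral_prod_mul (fun z : UnitAddCircle => (starRingEnd ℂ) (fourier k.1 z) * fourier l.1 z)
        (fun z : UnitAddCircle => (starRingEnd ℂ) (fourier k.2 z) * fourier l.2 z),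
      integral_conj_fourier_mul_fourier, integral_conj_fourier_mul_fourier]
    by_cases hkl : k = l
    · subst hkl
      have h2 : (fun t => (g k t * g k t : ℂ)) = fun t => ((g k t ^ 2 : ℝ) : ℂ) := by
        ext t
        push_cast
        ring
      rw [h2, integral_complex_ofReal, hgint]
      simp
    · rw [if_neg hkl]
      by_cases h3 : (k.1 : ℤ) = l.1
      · have h4 : ¬ (k.2 : ℤ) = l.2 := fun h4 =>
          hkl (Prod.ext (by exact_mod_cast h3) (by exact_mod_cast h4))
        rw [if_neg h4]
        simp
      · rw [if_neg h3]
        simp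
  · intro i j
    apply Lp.ext
    filter_upwards [coeFn_mulLpTop φ hφ ((hV (i, j)).toLp (V (i, j))), (hV (i, j)).coeFn_toLp,
      (hV (i + 1, j)).coeFn_toLp,
      Lp.coeFn_smul (w j i : ℂ) ((hV (i + 1, j)).toLp (V (i + 1, j)))] with x h1 h2 h3 h4
    rw [h1, h2, h4, Pi.smul_apply, h3]
    have hcs : c (i + 1, j) = c (i, j) * w j i := Finset.prod_range_succ _ _
    have h5 : (c (i, j) : ℂ) ≠ 0 := by exact_mod_cast (hc (i, j)).ne'
    have h6 : (w j i : ℂ) ≠ 0 := by exact_mod_cast (hw j i).ne'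
    simp only [φ, V, g, hcs, smul_eq_mul]
    push_cast
    rw [fourier_add, pow_succ]
    field_simp

/-! ### Berger measures, extremal values and backward extensions. -/

section
open MeasureTheory

theorem IsBergerMeasure.ae_mem_Icc {α : ℕ → ℝ} {μ : Measure ℝ} (hμ : IsBergerMeasure α μ) :
    ∀ᵐ t ∂μ, t ∈ Set.Icc 0 (‖unilateralShift α‖ ^ 2) :=
  mem_ae_iff.2 hμ.2.1

theorem IsBergerMeasure.integrable_pow {α : ℕ → ℝ} {μ : Measure ℝ} (hμ : IsBergerMeasure α μ)
    (k : ℕ) : Integrable (fun t : ℝ => t ^ k) μ := by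
  have := hμ.1
  refine Integrable.of_bound (by fun_prop) ((‖unilateralShift α‖ ^ 2) ^ k) ?_
  filter_upwards [hμ.ae_mem_Icc] with t ht
  rw [norm_pow, Real.norm_eq_abs, abs_of_nonneg ht.1]
  exact pow_le_pow_left₀ ht.1 ht.2 k

theorem lintegral_inv_ne_top_of_extremalValue_pos {μ : Measure ℝ} (h : 0 < extremalValue μ) :
    ∫⁻ t, (ENNReal.ofReal t)⁻¹ ∂μ ≠ ⊤ := by
  intro htop
  simp [extremalValue, htop] at h

/-- `(ENNReal.ofReal t)⁻¹ = ⊤` for every `t ≤ 0`, so a finite integral leaves no mass there; in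
particular there is no atom at `0`. -/
theorem ae_pos_of_extremalValue_pos {μ : Measure ℝ} (h : 0 < extremalValue μ) :
    ∀ᵐ t ∂μ, 0 < t := by
  filter_upwards [ae_lt_top (by fun_prop) (lintegral_inv_ne_top_of_extremalValue_pos h)] with t ht
  simpa [ENNReal.inv_lt_top] using ht

theorem lintegral_inv_eq_of_extremalValue_pos {μ : Measure ℝ} (h : 0 < extremalValue μ) :
    ∫⁻ t, (ENNReal.ofReal t)⁻¹ ∂μ = ∫⁻ t, ENNReal.ofReal t⁻¹ ∂μ := by
  apply lintegral_congr_ae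
  filter_upwards [ae_pos_of_extremalValue_pos h] with t ht
  rw [ENNReal.ofReal_inv_of_pos ht]

theorem integrable_inv_of_extremalValue_pos {μ : Measure ℝ} (h : 0 < extremalValue μ) :
    Integrable (fun t : ℝ => t⁻¹) μ := by
  refine ⟨by fun_prop, ?_⟩
  rw [hasFiniteIntegral_iff_ofReal, ← lintegral_inv_eq_of_extremalValue_pos h]
  · exact (lintegral_inv_ne_top_of_extremalValue_pos h).lt_top
  · filter_upwards [ae_pos_of_extremalValue_pos h] with t ht
    exact (inv_pos.2 ht).le

theorem extremalValue_sq_of_pos {μ : Measure ℝ} (h : 0 < extremalValue μ) :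
    extremalValue μ ^ 2 = (∫ t, t⁻¹ ∂μ)⁻¹ := by
  have hpos : 0 ≤ᵐ[μ] fun t : ℝ => t⁻¹ := by
    filter_upwards [ae_pos_of_extremalValue_pos h] with t ht
    exact (inv_pos.2 ht).le
  rw [integral_eq_lintegral_of_nonneg_ae hpos (by fun_prop),
    ← lintegral_inv_eq_of_extremalValue_pos h, extremalValue, Real.sq_sqrt ENNReal.toReal_nonneg,
    ENNReal.toReal_inv]

theorem extremalValue_nonneg (μ : Measure ℝ) : 0 ≤ extremalValue μ :=
  Real.sqrt_nonneg _

/-- The extremal value of a Berger measure is at most its first weight. -/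
theorem IsBergerMeasure.extremalValue_le {α : ℕ → ℝ} {μ : Measure ℝ} (hμ : IsBergerMeasure α μ)
    (hα : 0 < α 0) : extremalValue μ ≤ α 0 := by
  rcases (extremalValue_nonneg μ).eq_or_lt with h | h
  · rw [← h]
    exact hα.le
  have := hμ.1
  have hsq := extremalValue_sq_of_pos h
  have h1 : α 0 ^ 2 = ∫ t, t ∂μ := by simpa using hμ.2.2 1
  have hint : Integrable (fun t : ℝ => t) μ := by simpa using hμ.integrable_pow 1
  -- Jensen's inequality: the left integrand is the tangent line to `1/t` at the mean `α 0 ^ 2` of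
  -- `μ`.
  have hle : ∫ t, (2 / α 0 ^ 2 - t / (α 0 ^ 2) ^ 2) ∂μ ≤ ∫ t, t⁻¹ ∂μ := by
    refine integral_mono_ae ((integrable_const _).sub (hint.div_const _))
      (integrable_inv_of_extremalValue_pos h) ?_
    filter_upwards [ae_pos_of_extremalValue_pos h] with t ht
    rw [← sub_nonneg]
    have : t⁻¹ - (2 / α 0 ^ 2 - t / (α 0 ^ 2) ^ 2) = (α 0 ^ 2 - t) ^ 2 / (t * (α 0 ^ 2) ^ 2) := by
      field_simp
      ring
    rw [this]
    positivity
  rw [integral_sub (integrable_const _) (hint.div_const _), integral_const,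
    probReal_univ, one_smul, integral_div, ← h1] at hle
  have h2 : 2 / α 0 ^ 2 - α 0 ^ 2 / (α 0 ^ 2) ^ 2 = (α 0 ^ 2)⁻¹ := by
    field_simp
    ring
  rw [h2] at hle
  refine le_of_sq_le_sq ?_ hα.le
  rw [hsq]
  exact inv_le_of_inv_le₀ (by positivity) hle

/-- The square root of the density, with respect to `μ + δ₀`, of the Berger measure of the
extension of a shift with Berger measure `μ` by the weight `c`. -/
def backwardDensity (μ : Measure ℝ) (c t : ℝ) : ℝ :=
  if t = 0 then √(1 - c ^ 2 * ∫ t, t⁻¹ ∂μ) else c / √t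

theorem measurable_backwardDensity (μ : Measure ℝ) (c : ℝ) :
    Measurable (backwardDensity μ c) :=
  Measurable.ite (measurableSet_singleton 0) (by fun_prop) (by fun_prop)

theorem backwardDensity_sq_ae {μ : Measure ℝ} (h : 0 < extremalValue μ) (c : ℝ) :
    (fun t => backwardDensity μ c t ^ 2) =ᵐ[μ] fun t => c ^ 2 * t⁻¹ := by
  filter_upwards [ae_pos_of_extremalValue_pos h] with t ht
  rw [backwardDensity, if_neg ht.ne', div_pow, Real.sq_sqrt ht.le, div_eq_mul_inv]

/-- The bound `c ≤ extremalValue μ` says exactly that the mass left for the atom is nonnegative, so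
the square root is not truncated. -/
theorem backwardDensity_zero_sq {μ : Measure ℝ} {c : ℝ} (h : 0 < extremalValue μ) (hc : 0 < c)
    (hcμ : c ≤ extremalValue μ) :
    backwardDensity μ c 0 ^ 2 = 1 - c ^ 2 * ∫ t, t⁻¹ ∂μ := by
  rw [backwardDensity, if_pos rfl, Real.sq_sqrt]
  have h1 := extremalValue_sq_of_pos h
  have h2 : c ^ 2 ≤ extremalValue μ ^ 2 := by gcongr
  have h3 : 0 < ∫ t, t⁻¹ ∂μ := by
    rw [← inv_pos, ← h1]
    positivity
  rw [h1, le_inv_comm₀ (by positivity) h3, ← one_div, le_div_iff₀ (by positivity)] at h2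
  linarith

theorem pow_mul_backwardDensity_sq_ae {μ : Measure ℝ} (h : 0 < extremalValue μ) (c : ℝ) (i : ℕ) :
    (fun t => t ^ (i + 1) * backwardDensity μ c t ^ 2) =ᵐ[μ] fun t => c ^ 2 * t ^ i := by
  filter_upwards [backwardDensity_sq_ae h c, ae_pos_of_extremalValue_pos h] with t h1 h2
  rw [h1, pow_succ]
  field_simp

theorem IsBergerMeasure.integrable_backwardDensity {α : ℕ → ℝ} {μ : Measure ℝ}
    (hμ : IsBergerMeasure α μ) (h : 0 < extremalValue μ) (c : ℝ) (i : ℕ) :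
    Integrable (fun t => t ^ i * backwardDensity μ c t ^ 2) (μ + Measure.dirac 0) := by
  refine integrable_add_measure.2 ⟨?_, integrable_dirac enorm_lt_top⟩
  cases i with
  | zero =>
    simp only [pow_zero, one_mul]
    exact ((integrable_inv_of_extremalValue_pos h).const_mul _).congr
      (backwardDensity_sq_ae h c).symm
  | succ i =>
    exact ((hμ.integrable_pow i).const_mul _).congr (pow_mul_backwardDensity_sq_ae h c i).symm

theorem IsBergerMeasure.integral_backwardDensity {α : ℕ → ℝ} {μ : Measure ℝ}
    (hμ : IsBergerMeasure α μ) (h : 0 < extremalValue μ) {c : ℝ} (hc : 0 < c)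
    (hcμ : c ≤ extremalValue μ) {w : ℕ → ℝ} (hw0 : w 0 = c) (hw : ∀ i, w (i + 1) = α i) (i : ℕ) :
    ∫ t, t ^ i * backwardDensity μ c t ^ 2 ∂(μ + Measure.dirac 0) =
      ∏ m ∈ Finset.range i, w m ^ 2 := by
  have hint := integrable_add_measure.1 (hμ.integrable_backwardDensity h c i)
  rw [integral_add_measure hint.1 hint.2, integral_dirac]
  -- The atom at `0` contributes only to the zeroth moment, where it completes the total mass to
  -- `1`. For higher moments the factor `c² / t` lowers the exponent by one.
  cases i with
  | zero =>
    simp only [pow_zero, one_mul, Finset.range_zero, Finset.prod_empty]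
    rw [backwardDensity_zero_sq h hc hcμ, integral_congr_ae (backwardDensity_sq_ae h c),
      integral_const_mul]
    ring
  | succ i =>
    rw [integral_congr_ae (pow_mul_backwardDensity_sq_ae h c i), integral_const_mul, ← hμ.2.2,
      Finset.prod_range_succ']
    simp only [hw, hw0]
    ring

/-- A direct sum of backward extensions of a shift with Berger measure `μ`, by weights not
exceeding the extremal value of `μ`, is part of a normal operator. -/
theorem IsBergerMeasure.exists_normal_backward_extension {α : ℕ → ℝ} {μ : Measure ℝ}
    (hμ : IsBergerMeasure α μ) (hα : ∀ i, 0 < α i) (h : 0 < extremalValue μ) (w : ℕ → ℕ → ℝ)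
    (hw0 : ∀ j, 0 < w j 0) (hwμ : ∀ j, w j 0 ≤ extremalValue μ)
    (hw : ∀ j i, w j (i + 1) = α i) :
    ∃ (K : Type) (_ : NormedAddCommGroup K) (_ : InnerProductSpace ℂ K) (_ : CompleteSpace K)
      (N : K →L[ℂ] K) (v : ℕ × ℕ → K), IsStarNormal N ∧ Orthonormal ℂ v ∧
        ∀ i j, N (v (i, j)) = (w j i : ℂ) • v (i + 1, j) := by
  have := hμ.1
  refine exists_normal_of_moments (μ + Measure.dirac 0) (‖unilateralShift α‖ ^ 2) ?_ w ?_
    (fun j => backwardDensity μ (w j 0)) (fun j => measurable_backwardDensity _ _)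
    (fun j i => hμ.integrable_backwardDensity h _ i)
    (fun j i => hμ.integral_backwardDensity h (hw0 j) (hwμ j) rfl (hw j) i)
  · rw [ae_add_measure_iff]
    refine ⟨hμ.ae_mem_Icc, ?_⟩
    exact (ae_dirac_iff (p := (· ∈ Set.Icc 0 (‖unilateralShift α‖ ^ 2))) measurableSet_Icc).2
      ⟨le_rfl, sq_nonneg _⟩
  · rintro j (_ | i)
    · exact hw0 j
    · rw [hw]
      exact hα i

end

/-! ### Coordinates of weighted shifts and the hyponormality criterion. -/

theorem weightedShift_apply_add {I : Type*} [AddCancelCommMonoid I] (ε : I) (w : I → ℝ)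
    (hw : ∃ C, ∀ k, |w k| ≤ C) (x : lp (fun _ : I => ℂ) 2) (k : I) :
    weightedShift ε w x (k + ε) = w k * x k := by
  rw [weightedShift, dif_pos hw]
  exact (add_left_injective ε).extend_apply (fun k => (w k : ℂ) * x k) 0 k

theorem weightedShift_apply_of_notMem {I : Type*} [AddCancelCommMonoid I] (ε : I) (w : I → ℝ)
    (x : lp (fun _ : I => ℂ) 2) {m : I} (hm : ¬ ∃ k, k + ε = m) :
    weightedShift ε w x m = 0 := by
  rw [weightedShift]
  split_ifs with hw
  · change shiftFun ε w x m = 0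
    simp [shiftFun, Function.extend_apply' _ _ _ hm]
  · rfl

theorem star_weightedShift_apply {I : Type*} [AddCancelCommMonoid I] (ε : I) (w : I → ℝ)
    (hw : ∃ C, ∀ k, |w k| ≤ C) (x : lp (fun _ : I => ℂ) 2) (k : I) :
    (star (weightedShift ε w) x) k = w k * x (k + ε) := by
  classical
  have h1 := ContinuousLinearMap.adjoint_inner_right (weightedShift ε w)
    (lp.single 2 k (1 : ℂ)) x
  rw [weightedShift_single ε w hw, lp.inner_single_left, inner_smul_left,
    lp.inner_single_left] at h1
  simpa [ContinuousLinearMap.star_eq_adjoint] using h1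

theorem hasSum_norm_sq {I : Type*} (x : lp (fun _ : I => ℂ) 2) :
    HasSum (fun k => ‖x k‖ ^ 2) (‖x‖ ^ 2) := by
  have h := Complex.hasSum_re (lp.hasSum_inner x x)
  rw [inner_self_eq_norm_sq_to_K] at h
  convert h using 2 with k
  · rw [inner_self_eq_norm_sq_to_K]
    norm_cast
  · norm_cast

/-- Moving operators across the inner product gives `⟪T_j x_i, T_i x_j⟫ - ⟪T_i* x_i, T_j* x_j⟫`; the
subtracted terms add up to a single square. -/
theorem hyponormal_form_pair {H : Type*} [NormedAddCommGroup H] [InnerProductSpace ℂ H]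
    [CompleteSpace H] (T : Fin 2 → H →L[ℂ] H) (x : Fin 2 → H) :
    (∑ i, inner ℂ (x i) (∑ j, (star (T j) * T i - T i * star (T j)) (x j))).re =
      ‖T 0 (x 0)‖ ^ 2 + ‖T 1 (x 1)‖ ^ 2 + 2 * (inner ℂ (T 1 (x 0)) (T 0 (x 1))).re
        - ‖star (T 0) (x 0) + star (T 1) (x 1)‖ ^ 2 := by
  have h1 (A B : H →L[ℂ] H) (y z : H) :
      inner ℂ y ((star B * A - A * star B) z) =
        inner ℂ (B y) (A z) - inner ℂ (star A y) (star B z) := by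
    change inner ℂ y (ContinuousLinearMap.adjoint B (A z) - A (star B z)) = _
    rw [inner_sub_right, ContinuousLinearMap.adjoint_inner_right, ContinuousLinearMap.star_eq_adjoint,
      ContinuousLinearMap.star_eq_adjoint, ContinuousLinearMap.adjoint_inner_left]
  have h2 (y z : H) : (inner ℂ y z).re = (inner ℂ z y).re := by
    rw [← inner_conj_symm, Complex.conj_re]
  have h3 (y : H) : ‖y‖ ^ 2 = (inner ℂ y y).re := by
    rw [inner_self_eq_norm_sq_to_K]
    norm_cast
  simp only [Fin.sum_univ_two, inner_add_right, h1, Complex.add_re, Complex.sub_re, h3,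
    inner_add_left]
  rw [h2 (T 0 (x 1)) (T 1 (x 0))]
  ring

theorem quadratic_form_nonneg {p q r : ℝ} (hp : 0 ≤ p) (hq : 0 ≤ q) (hr : r ^ 2 ≤ p * q)
    (x y : ℂ) : 0 ≤ p * ‖x‖ ^ 2 + q * ‖y‖ ^ 2 + 2 * r * (inner ℂ x y).re := by
  have h1 : |(inner ℂ x y).re| ≤ ‖x‖ * ‖y‖ :=
    (Complex.abs_re_le_norm _).trans (norm_inner_le_norm x y)
  have h2 : |r| ≤ √p * √q := by
    rw [← Real.sqrt_mul hp]
    exact Real.abs_le_sqrt hr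
  have h3 : |r * (inner ℂ x y).re| ≤ (√p * √q) * (‖x‖ * ‖y‖) := by
    rw [abs_mul]
    gcongr
  have h4 := (abs_le.1 h3).1
  nlinarith [sq_nonneg (√p * ‖x‖ - √q * ‖y‖), Real.sq_sqrt hp, Real.sq_sqrt hq]

/-- A sufficient condition for hyponormality of a 2-variable weighted shift: positivity of the
2-by-2 matrices of weights at each lattice point. -/
theorem isHyponormalTuple_twoVarShift {α β : ℕ × ℕ → ℝ} (hα : ∃ C, ∀ k, |α k| ≤ C)
    (hβ : ∃ C, ∀ k, |β k| ≤ C) (h1 : ∀ k, 0 ≤ α (k + (1, 0)) ^ 2 - α k ^ 2)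
    (h2 : ∀ k, 0 ≤ β (k + (0, 1)) ^ 2 - β k ^ 2)
    (h3 : ∀ k, (α (k + (0, 1)) * β (k + (1, 0)) - α k * β k) ^ 2 ≤
      (α (k + (1, 0)) ^ 2 - α k ^ 2) * (β (k + (0, 1)) ^ 2 - β k ^ 2)) :
    IsHyponormalTuple (twoVarShift α β) := by
  intro x
  rw [hyponormal_form_pair]
  set A := weightedShift ((1, 0) : ℕ × ℕ) α with hA
  set B := weightedShift ((0, 1) : ℕ × ℕ) β with hB
  change 0 ≤ ‖A (x 0)‖ ^ 2 + ‖B (x 1)‖ ^ 2 + 2 * (inner ℂ (B (x 0)) (A (x 1))).re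
    - ‖star A (x 0) + star B (x 1)‖ ^ 2
  have hinj (c : ℕ × ℕ) : Function.Injective (fun k : ℕ × ℕ => k + c) := add_left_injective c
  have sA := (hasSum_norm_sq (A (x 0))).summable
  have sB := (hasSum_norm_sq (B (x 1))).summable
  have iA : Summable fun k : ℕ × ℕ => ‖A (x 0) (k + ((1, 0) + (1, 0)))‖ ^ 2 :=
    sA.comp_injective (hinj _)
  have iB : Summable fun k : ℕ × ℕ => ‖B (x 1) (k + ((0, 1) + (0, 1)))‖ ^ 2 :=
    sB.comp_injective (hinj _)
  -- Coordinates of `x 0` on the axis `k.1 = 0` do not enter `star A (x 0)`; their nonnegative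
  -- contribution is dropped. The rest regroups by `k` into forms in `x 0 (k + (1, 0))` and `x 1 (k
  -- + (0, 1))`.
  have tA : ∑' k : ℕ × ℕ, ‖A (x 0) (k + ((1, 0) + (1, 0)))‖ ^ 2 ≤ ‖A (x 0)‖ ^ 2 := by
    rw [← (hasSum_norm_sq (A (x 0))).tsum_eq]
    exact tsum_comp_le_tsum_of_inj sA (fun _ => by positivity) (hinj _)
  have tB : ∑' k : ℕ × ℕ, ‖B (x 1) (k + ((0, 1) + (0, 1)))‖ ^ 2 ≤ ‖B (x 1)‖ ^ 2 := by
    rw [← (hasSum_norm_sq (B (x 1))).tsum_eq]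
    exact tsum_comp_le_tsum_of_inj sB (fun _ => by positivity) (hinj _)
  -- Nothing is lost in the cross term: on each axis one of the two factors vanishes.
  have hG : HasSum (fun k : ℕ × ℕ => inner ℂ (B (x 0) (k + ((1, 0) + (0, 1))))
      (A (x 1) (k + ((1, 0) + (0, 1))))) (inner ℂ (B (x 0)) (A (x 1))) := by
    have hG0 := lp.hasSum_inner (𝕜 := ℂ) (B (x 0)) (A (x 1))
    refine (Function.Injective.hasSum_iff (f := fun m : ℕ × ℕ => inner ℂ (B (x 0) m) (A (x 1) m))
      (hinj ((1, 0) + (0, 1))) ?_).2 hG0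
    rintro ⟨m, n⟩ hmn
    by_cases hm : m = 0
    · have : A (x 1) (m, n) = 0 := by
        apply weightedShift_apply_of_notMem
        rintro ⟨k, hk⟩
        simp [Prod.ext_iff, hm] at hk
      rw [this, inner_zero_right]
    by_cases hn : n = 0
    · have : B (x 0) (m, n) = 0 := by
        apply weightedShift_apply_of_notMem
        rintro ⟨k, hk⟩
        simp [Prod.ext_iff, hn] at hk
      rw [this, inner_zero_left]
    exact absurd ⟨(m - 1, n - 1), by simp [Prod.ext_iff]; omega⟩ hmn
  have hG' := (Complex.hasSum_re hG).mul_left 2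
  have hS := hasSum_norm_sq (star A (x 0) + star B (x 1))
  have hT := ((iA.hasSum.add iB.hasSum).add hG').sub hS
  have h0 := hT.nonneg fun k => ?_
  · linarith
  have e1 : A (x 0) (k + ((1, 0) + (1, 0))) = α (k + (1, 0)) * x 0 (k + (1, 0)) := by
    rw [← add_assoc]
    exact weightedShift_apply_add _ _ hα _ _
  have e2 : B (x 1) (k + ((0, 1) + (0, 1))) = β (k + (0, 1)) * x 1 (k + (0, 1)) := by
    rw [← add_assoc]
    exact weightedShift_apply_add _ _ hβ _ _
  have e3 : B (x 0) (k + ((1, 0) + (0, 1))) = β (k + (1, 0)) * x 0 (k + (1, 0)) := by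
    rw [← add_assoc]
    exact weightedShift_apply_add _ _ hβ _ _
  have e4 : A (x 1) (k + ((1, 0) + (0, 1))) = α (k + (0, 1)) * x 1 (k + (0, 1)) := by
    rw [add_comm (1, 0), ← add_assoc]
    exact weightedShift_apply_add _ _ hα _ _
  have e5 : (star A (x 0) + star B (x 1) : lp (fun _ : ℕ × ℕ => ℂ) 2) k =
      α k * x 0 (k + (1, 0)) + β k * x 1 (k + (0, 1)) := by
    rw [lp.coeFn_add, Pi.add_apply, star_weightedShift_apply _ _ hα,
      star_weightedShift_apply _ _ hβ]
  rw [e1, e2, e3, e4, e5]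
  have h := quadratic_form_nonneg (h1 k) (h2 k) (h3 k) (x 0 (k + (1, 0))) (x 1 (k + (0, 1)))
  generalize x 0 (k + (1, 0)) = y at h ⊢
  generalize x 1 (k + (0, 1)) = z at h ⊢
  refine h.trans_eq ?_
  simp only [RCLike.inner_apply, map_mul, Complex.conj_ofReal, ← Complex.normSq_eq_norm_sq,
    Complex.normSq_apply, Complex.mul_re, Complex.mul_im, Complex.add_re, Complex.add_im,
    Complex.ofReal_re, Complex.ofReal_im, Complex.conj_re, Complex.conj_im]
  ring

/-! ### The weights of the theorem. -/

theorem alphaWeights_zero (ξ : ℕ → ℝ) (a : ℝ) : alphaWeights ξ a (0, 0) = a := if_pos rfl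

theorem betaWeights_zero (η : ℕ → ℝ) (b : ℝ) : betaWeights η b (0, 0) = b := if_pos rfl

theorem alphaWeights_of_ne (ξ : ℕ → ℝ) (a : ℝ) {k : ℕ × ℕ} (hk : k ≠ (0, 0)) :
    alphaWeights ξ a k = ξ k.1 := if_neg hk

theorem betaWeights_of_ne (η : ℕ → ℝ) (b : ℝ) {k : ℕ × ℕ} (hk : k ≠ (0, 0)) :
    betaWeights η b k = η k.2 := if_neg hk

theorem exists_abs_le_of_bddAbove {ξ : ℕ → ℝ} (hξ : ∀ k, 0 < ξ k)
    (hb : BddAbove (Set.range ξ)) : ∃ C, ∀ k, |ξ k| ≤ C := by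
  obtain ⟨C, hC⟩ := hb
  exact ⟨C, fun k => by rw [abs_of_pos (hξ k)]; exact hC ⟨k, rfl⟩⟩

theorem exists_abs_alphaWeights_le {ξ : ℕ → ℝ} (a : ℝ) (hb : ∃ C, ∀ k, |ξ k| ≤ C) :
    ∃ C, ∀ k, |alphaWeights ξ a k| ≤ C := by
  obtain ⟨C, hC⟩ := hb
  refine ⟨max |a| C, fun k => ?_⟩
  unfold alphaWeights
  split_ifs
  · exact le_max_left _ _
  · exact (hC _).trans (le_max_right _ _)

theorem exists_abs_betaWeights_le {η : ℕ → ℝ} (b : ℝ) (hb : ∃ C, ∀ k, |η k| ≤ C) :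
    ∃ C, ∀ k, |betaWeights η b k| ≤ C := by
  obtain ⟨C, hC⟩ := hb
  refine ⟨max |b| C, fun k => ?_⟩
  unfold betaWeights
  split_ifs
  · exact le_max_left _ _
  · exact (hC _).trans (le_max_right _ _)

theorem twoVarShift_commute {α β : ℕ × ℕ → ℝ} (hα : ∃ C, ∀ k, |α k| ≤ C)
    (hβ : ∃ C, ∀ k, |β k| ≤ C) (hcomm : ∀ k, β k * α (k + (0, 1)) = α k * β (k + (1, 0))) :
    twoVarShift α β 0 * twoVarShift α β 1 = twoVarShift α β 1 * twoVarShift α β 0 := by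
  apply lp.ext_continuousLinearMap (by norm_num)
  intro k
  ext1
  change weightedShift ((1, 0) : ℕ × ℕ) α (weightedShift ((0, 1) : ℕ × ℕ) β (lp.single 2 k 1)) =
    weightedShift ((0, 1) : ℕ × ℕ) β (weightedShift ((1, 0) : ℕ × ℕ) α (lp.single 2 k 1))
  rw [weightedShift_single _ _ hα, weightedShift_single _ _ hβ, map_smul, map_smul,
    weightedShift_single _ _ hα, weightedShift_single _ _ hβ, smul_smul, smul_smul,
    add_right_comm k (0, 1) (1, 0)]
  congr 1
  exact_mod_cast hcomm k

/-- The bottom row has weights `a, ξ 1, ξ 2, …` and every other row `ξ 0, ξ 1, ξ 2, …`, so all rows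
extend the shift with measure `μ`. -/
theorem IsBergerMeasure.isSubnormalOp_alphaWeights {ξ : ℕ → ℝ} {a : ℝ}
    (hξ : ∀ k, 0 < ξ k) (hb : ∃ C, ∀ k, |ξ k| ≤ C) {μ : MeasureTheory.Measure ℝ}
    (hμ : IsBergerMeasure (fun k => ξ (k + 1)) μ) (ha : 0 < a) (haμ : a ≤ extremalValue μ)
    (h0μ : ξ 0 ≤ extremalValue μ) :
    IsSubnormalOp (weightedShift ((1, 0) : ℕ × ℕ) (alphaWeights ξ a)) := by
  obtain ⟨K, _, _, _, N, v, hN, hv, hNv⟩ := hμ.exists_normal_backward_extension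
    (fun i => hξ _) (ha.trans_le haμ) (fun j i => alphaWeights ξ a (i, j))
    (fun j => by unfold alphaWeights; split_ifs; exacts [ha, hξ _])
    (fun j => by unfold alphaWeights; split_ifs; exacts [haμ, h0μ])
    (fun j i => alphaWeights_of_ne ξ a (by simp))
  exact .of_orthonormal _ _ (exists_abs_alphaWeights_le a hb) N hN v hv fun k => hNv k.1 k.2

theorem IsBergerMeasure.isSubnormalOp_betaWeights {η : ℕ → ℝ} {b : ℝ}
    (hη : ∀ k, 0 < η k) (hbd : ∃ C, ∀ k, |η k| ≤ C) {μ : MeasureTheory.Measure ℝ}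
    (hμ : IsBergerMeasure (fun k => η (k + 1)) μ) (hb : 0 < b) (hbμ : b ≤ extremalValue μ)
    (h0μ : η 0 ≤ extremalValue μ) :
    IsSubnormalOp (weightedShift ((0, 1) : ℕ × ℕ) (betaWeights η b)) := by
  obtain ⟨K, _, _, _, N, v, hN, hv, hNv⟩ := hμ.exists_normal_backward_extension
    (fun i => hη _) (hb.trans_le hbμ) (fun j i => betaWeights η b (j, i))
    (fun j => by unfold betaWeights; split_ifs; exacts [hb, hη _])
    (fun j => by unfold betaWeights; split_ifs; exacts [hbμ, h0μ])
    (fun j i => betaWeights_of_ne η b (by simp))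
  -- The summands are now the columns, so the position within a summand is the second lattice
  -- coordinate.
  exact .of_orthonormal _ _ (exists_abs_betaWeights_le b hbd) N hN (fun k => v k.swap)
    (hv.comp _ Prod.swap_injective) fun k => hNv k.2 k.1

/-- Away from the origin `α` depends only on `k.1` and `β` only on `k.2`, so the off-diagonal entry
vanishes and monotonicity suffices. -/
theorem isHyponormalTuple_alphaWeights_betaWeights {ξ η : ℕ → ℝ} {a b : ℝ}
    (hξ : ∀ k, 0 < ξ k) (hη : ∀ k, 0 < η k)
    (hξb : ∃ C, ∀ k, |ξ k| ≤ C) (hηb : ∃ C, ∀ k, |η k| ≤ C)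
    (hξm : Monotone ξ) (hηm : Monotone η) (ha : a ^ 2 ≤ ξ 1 ^ 2) (hb : b ^ 2 ≤ η 1 ^ 2)
    (hdet : (ξ 0 * η 0 - a * b) ^ 2 ≤ (ξ 1 ^ 2 - a ^ 2) * (η 1 ^ 2 - b ^ 2)) :
    IsHyponormalTuple (twoVarShift (alphaWeights ξ a) (betaWeights η b)) := by
  have hξ2 (n : ℕ) : 0 ≤ ξ (n + 1) ^ 2 - ξ n ^ 2 :=
    sub_nonneg.2 (pow_le_pow_left₀ (hξ n).le (hξm n.le_succ) 2)
  have hη2 (n : ℕ) : 0 ≤ η (n + 1) ^ 2 - η n ^ 2 :=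
    sub_nonneg.2 (pow_le_pow_left₀ (hη n).le (hηm n.le_succ) 2)
  have e1 (k : ℕ × ℕ) : alphaWeights ξ a (k + (1, 0)) = ξ (k.1 + 1) :=
    alphaWeights_of_ne ξ a (by simp [Prod.ext_iff])
  have e2 (k : ℕ × ℕ) : alphaWeights ξ a (k + (0, 1)) = ξ k.1 :=
    alphaWeights_of_ne ξ a (by simp [Prod.ext_iff])
  have e3 (k : ℕ × ℕ) : betaWeights η b (k + (1, 0)) = η k.2 :=
    betaWeights_of_ne η b (by simp [Prod.ext_iff])
  have e4 (k : ℕ × ℕ) : betaWeights η b (k + (0, 1)) = η (k.2 + 1) :=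
    betaWeights_of_ne η b (by simp [Prod.ext_iff])
  refine isHyponormalTuple_twoVarShift (exists_abs_alphaWeights_le a hξb)
    (exists_abs_betaWeights_le b hηb) (fun k => ?_) (fun k => ?_) (fun k => ?_)
  all_goals
    simp only [e1, e2, e3, e4]
    by_cases hk : k = (0, 0)
  · subst hk
    rw [alphaWeights_zero]
    exact sub_nonneg.2 ha
  · rw [alphaWeights_of_ne ξ a hk]
    exact hξ2 _
  · subst hk
    rw [betaWeights_zero]
    exact sub_nonneg.2 hb
  · rw [betaWeights_of_ne η b hk]
    exact hη2 _
  · subst hk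
    rw [alphaWeights_zero, betaWeights_zero]
    exact hdet
  · rw [alphaWeights_of_ne ξ a hk, betaWeights_of_ne η b hk, sub_self, zero_pow two_ne_zero]
    exact mul_nonneg (hξ2 _) (hη2 _)

theorem IsSubnormalTuple.le_of_alphaWeights_betaWeights {ξ η : ℕ → ℝ} {a b : ℝ}
    (hξ : ∀ k, 0 < ξ k) (hη : ∀ k, 0 < η k)
    (hξb : ∃ C, ∀ k, |ξ k| ≤ C) (hηb : ∃ C, ∀ k, |η k| ≤ C) (hab : a * η 0 = b * ξ 0)
    (h : IsSubnormalTuple (twoVarShift (alphaWeights ξ a) (betaWeights η b))) :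
    a ^ 2 * (ξ 1 ^ 2 * η 0 ^ 2 + ξ 0 ^ 2 * η 1 ^ 2 - ξ 0 ^ 2 * η 0 ^ 2) ≤
      ξ 0 ^ 2 * ξ 1 ^ 2 * η 1 ^ 2 := by
  let e : ℕ × ℕ → lp (fun _ : ℕ × ℕ => ℂ) 2 := fun k => lp.single 2 k (1 : ℂ)
  have he (k) : ‖e k‖ = 1 := by
    simp [e, lp.norm_single]
  have hA (k) : twoVarShift (alphaWeights ξ a) (betaWeights η b) 0 (e k) =
      (alphaWeights ξ a k : ℂ) • e (k + (1, 0)) :=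
    weightedShift_single _ _ (exists_abs_alphaWeights_le a hξb) k
  have hB (k) : twoVarShift (alphaWeights ξ a) (betaWeights η b) 1 (e k) =
      (betaWeights η b k : ℂ) • e (k + (0, 1)) :=
    weightedShift_single _ _ (exists_abs_betaWeights_le b hηb) k
  have hpow (S : lp (fun _ : ℕ × ℕ => ℂ) 2 →L[ℂ] lp (fun _ : ℕ × ℕ => ℂ) 2) (y) :
      (S ^ 2) y = S (S y) := by
    rw [pow_two]
    rfl
  -- With these `p`, `q` the moments of order two are `p` or `q` multiples of lower ones, and the
  -- sum collapses to `p * q * (p * q - q * a ^ 2 - p * b ^ 2 + b ^ 2 * ξ 0 ^ 2)`.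
  have key := h.moment_nonneg (e (0, 0)) (ξ 1 ^ 2) (η 1 ^ 2)
  simp only [hpow, hA, hB, map_smul, norm_smul, he, Prod.mk_add_mk, alphaWeights, betaWeights,
    Complex.norm_real, Real.norm_eq_abs, mul_pow, sq_abs] at key
  norm_num at key
  have hb2 : b ^ 2 * ξ 0 ^ 2 = a ^ 2 * η 0 ^ 2 := by
    rw [← mul_pow, ← mul_pow, hab]
  have h1 : 0 ≤ (ξ 1 ^ 2 * η 1 ^ 2) * (ξ 0 ^ 2 * ξ 1 ^ 2 * η 1 ^ 2 -
      a ^ 2 * (ξ 1 ^ 2 * η 0 ^ 2 + ξ 0 ^ 2 * η 1 ^ 2 - ξ 0 ^ 2 * η 0 ^ 2)) := by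
    have := mul_nonneg (sq_nonneg (ξ 0)) key
    linear_combination this - ξ 1 ^ 2 * η 1 ^ 2 * (ξ 1 ^ 2 - ξ 0 ^ 2) * hb2
  have h2 := nonneg_of_mul_nonneg_right h1 (mul_pos (pow_pos (hξ 1) 2) (pow_pos (hη 1) 2))
  linarith

/-- The bound `η₀² ≤ v` makes the threshold for hyponormality at most the one for subnormality of
the backward extensions. -/
theorem threshold_le_of_le_root {x₀ x₁ y₀ y₁ E v : ℝ} (hx₀ : 0 < x₀)
    (hv : v = (x₁ * (y₁ - E) + 2 * x₀ * E -
      √((y₁ - E) * (x₁ ^ 2 * (y₁ - E) + 4 * x₀ * E * (x₁ - x₀)))) / (2 * x₀))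
    (hy : y₀ ≤ v) :
    y₀ * (x₁ * y₁ - x₀ * y₀) ≤ E * (x₀ * y₁ + x₁ * y₀ - 2 * x₀ * y₀) := by
  rw [hv, le_div_iff₀ (by positivity)] at hy
  -- The goal is nonnegativity of `x₀ y² - (x₁ (y₁ - E) + 2 x₀ E) y + x₀ y₁ E` at `y = y₀`; the
  -- radicand is its discriminant and `v` its smaller root. Squaring completes the square.
  have h1 := (Real.sqrt_le_iff.1 (show √((y₁ - E) * (x₁ ^ 2 * (y₁ - E) + 4 * x₀ * E * (x₁ - x₀))) ≤
    x₁ * (y₁ - E) + 2 * x₀ * E - 2 * x₀ * y₀ by linarith)).2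
  have h2 : 0 ≤ (4 * x₀) * (E * (x₀ * y₁ + x₁ * y₀ - 2 * x₀ * y₀) - y₀ * (x₁ * y₁ - x₀ * y₀)) := by
    linarith
  linarith [nonneg_of_mul_nonneg_right h2 (by positivity)]

end

/-! ### Comparison of the thresholds and the conclusion. -/

theorem mainTheorem1
    (ξ η : ℕ → ℝ) (a b : ℝ)
    -- two strictly increasing sequences of weights (bounded, positive)
    (hξ_pos : ∀ k, 0 < ξ k) (hη_pos : ∀ k, 0 < η k)
    (hξ_bdd : BddAbove (Set.range ξ)) (hη_bdd : BddAbove (Set.range η))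
    (hξ_mono : StrictMono ξ) (hη_mono : StrictMono η)
    (ha : 0 < a ∧ a < 1) (hb : 0 < b ∧ b < 1)
    -- the weighted shifts `W_ξ` and `W_η` are subnormal
    (hξ_sub : IsSubnormalOp (unilateralShift ξ))
    (hη_sub : IsSubnormalOp (unilateralShift η))
    (hab : a * η 0 = b * ξ 0)
    -- the Berger measures of the restrictions of `W_ξ` and `W_η` to the closed span of
    -- `e_1, e_2, …`, that is, of the shifts with weights `ξ_1, ξ_2, …` and `η_1, η_2, …`
    (νM ωM : MeasureTheory.Measure ℝ)
    (hνM : IsBergerMeasure (fun k => ξ (k + 1)) νM)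
    (hωM : IsBergerMeasure (fun k => η (k + 1)) ωM)
    (h s s₂ ηe u v : ℝ)
    (h_def : h = ξ 0 * √((ξ 1 ^ 2 * η 1 ^ 2 - ξ 0 ^ 2 * η 0 ^ 2) /
      (ξ 0 ^ 2 * η 1 ^ 2 + ξ 1 ^ 2 * η 0 ^ 2 - 2 * ξ 0 ^ 2 * η 0 ^ 2)))
    (s_def : s = √((ξ 0 ^ 2 * ξ 1 ^ 2 * η 1 ^ 2) /
      (ξ 1 ^ 2 * η 0 ^ 2 + ξ 0 ^ 2 * η 1 ^ 2 - ξ 0 ^ 2 * η 0 ^ 2)))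
    (ηe_def : ηe = extremalValue ωM)
    (s₂_def : s₂ = ξ 0 / η 0 * ηe)
    (u_def : u = (ξ 0 ^ 2 * ηe ^ 2 * η 1 ^ 2) /
      (ξ 1 ^ 2 * (η 1 ^ 2 - ηe ^ 2) + ξ 0 ^ 2 * ηe ^ 2))
    (v_def : v = (ξ 1 ^ 2 * (η 1 ^ 2 - ηe ^ 2) + 2 * ξ 0 ^ 2 * ηe ^ 2 -
      √((η 1 ^ 2 - ηe ^ 2) * (ξ 1 ^ 4 * (η 1 ^ 2 - ηe ^ 2) +
        4 * ξ 0 ^ 2 * ηe ^ 2 * (ξ 1 ^ 2 - ξ 0 ^ 2)))) / (2 * ξ 0 ^ 2))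
    (hs₂ : s₂ = extremalValue νM)
    (hη0 : η 0 ≤ min u v)
    (hsa : s < a) (hah : a ≤ h) :
    let T := twoVarShift (alphaWeights ξ a) (betaWeights η b)
    T 0 * T 1 = T 1 * T 0 ∧
      IsSubnormalOp (T 0) ∧
      IsSubnormalOp (T 1) ∧
      IsHyponormalTuple T ∧
      ¬ IsSubnormalTuple T := by
  intro T
  have hξb := exists_abs_le_of_bddAbove hξ_pos hξ_bdd
  have hηb := exists_abs_le_of_bddAbove hη_pos hη_bdd
  have x0 := hξ_pos 0
  have x1 := hξ_pos 1
  have y0 := hη_pos 0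
  have y1 := hη_pos 1
  have hx : ξ 0 ^ 2 < ξ 1 ^ 2 := pow_lt_pow_left₀ (hξ_mono one_pos) x0.le two_ne_zero
  have hy : η 0 ^ 2 < η 1 ^ 2 := pow_lt_pow_left₀ (hη_mono one_pos) y0.le two_ne_zero
  have a0 := ha.1
  have b0 := hb.1
  have hxy : 0 < (ξ 1 ^ 2 - ξ 0 ^ 2) * (η 1 ^ 2 - η 0 ^ 2) :=
    mul_pos (sub_pos.2 hx) (sub_pos.2 hy)
  have hD₁ : 0 < ξ 1 ^ 2 * η 0 ^ 2 + ξ 0 ^ 2 * η 1 ^ 2 - ξ 0 ^ 2 * η 0 ^ 2 := by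
    have := mul_pos (sub_pos.2 hx) (pow_pos y0 2)
    have := mul_pos (pow_pos x0 2) (pow_pos y1 2)
    linarith
  have hD₂ : 0 < ξ 0 ^ 2 * η 1 ^ 2 + ξ 1 ^ 2 * η 0 ^ 2 - 2 * ξ 0 ^ 2 * η 0 ^ 2 := by
    have := mul_pos (sub_pos.2 hx) (pow_pos y0 2)
    have := mul_pos (pow_pos x0 2) (sub_pos.2 hy)
    linarith
  have hlow : ξ 0 ^ 2 * ξ 1 ^ 2 * η 1 ^ 2 <
      a ^ 2 * (ξ 1 ^ 2 * η 0 ^ 2 + ξ 0 ^ 2 * η 1 ^ 2 - ξ 0 ^ 2 * η 0 ^ 2) := by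
    rw [s_def, Real.sqrt_lt' a0, div_lt_iff₀ hD₁] at hsa
    exact hsa
  have hup : a ^ 2 * (ξ 0 ^ 2 * η 1 ^ 2 + ξ 1 ^ 2 * η 0 ^ 2 - 2 * ξ 0 ^ 2 * η 0 ^ 2) ≤
      ξ 0 ^ 2 * (ξ 1 ^ 2 * η 1 ^ 2 - ξ 0 ^ 2 * η 0 ^ 2) := by
    have hnn : 0 ≤ ξ 1 ^ 2 * η 1 ^ 2 - ξ 0 ^ 2 * η 0 ^ 2 :=
      sub_nonneg.2 (mul_le_mul hx.le hy.le (by positivity) (by positivity))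
    have h1 := pow_le_pow_left₀ a0.le hah 2
    rwa [h_def, mul_pow, Real.sq_sqrt (div_nonneg hnn hD₂.le), ← mul_div_assoc,
      le_div_iff₀ hD₂] at h1
  -- `ξ 0 < s`, since `ξ 1 ^ 2 * η 1 ^ 2` exceeds the denominator of `s ^ 2` by the product `hxy`.
  have hξa : ξ 0 < a := by
    refine lt_of_pow_lt_pow_left₀ 2 a0.le ?_
    refine lt_of_mul_lt_mul_right (lt_of_le_of_lt ?_ hlow) hD₁.le
    have := mul_pos (pow_pos x0 2) hxy
    linarith
  have hηb' : η 0 < b := by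
    have h1 : η 0 * ξ 0 < b * ξ 0 := by
      rw [← hab, mul_comm]
      exact mul_lt_mul_of_pos_right hξa y0
    exact lt_of_mul_lt_mul_right h1 x0.le
  -- The quadratic is in `η 0 ^ 2`, while the bound is on `η 0`; `η 0 < b < 1` bridges the two.
  have hηv : η 0 ^ 2 ≤ v := by
    have h1 : η 0 ≤ v := hη0.trans (min_le_right _ _)
    have h2 : η 0 * η 0 ≤ η 0 * 1 := mul_le_mul_of_nonneg_left (hηb'.trans hb.2).le y0.le
    linarith
  have hroot := threshold_le_of_le_root (x₁ := ξ 1 ^ 2) (y₁ := η 1 ^ 2) (E := ηe ^ 2)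
    (pow_pos x0 2) (by rw [v_def, ← pow_mul]) hηv
  have hηe0 : 0 ≤ ηe := ηe_def ▸ extremalValue_nonneg _
  -- Combining `a ≤ h` with `h ≤ s₂`. The single inequality yields both `b ≤ ηe` and `a ≤ s₂`.
  have haη : a * η 0 ≤ ξ 0 * ηe := by
    refine le_of_sq_le_sq ?_ (by positivity)
    have h1 := mul_le_mul_of_nonneg_right hup (sq_nonneg (η 0))
    have h2 := mul_le_mul_of_nonneg_left hroot (sq_nonneg (ξ 0))
    refine le_of_mul_le_mul_right ?_ hD₂
    linarith
  have hbe : b ≤ extremalValue ωM := by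
    rw [← ηe_def]
    refine le_of_mul_le_mul_right ?_ x0
    rw [← hab, mul_comm ηe]
    exact haη
  have hae : a ≤ extremalValue νM := by
    rw [← hs₂, s₂_def, div_mul_eq_mul_div, le_div_iff₀ y0]
    exact haη
  have haξ : a ^ 2 ≤ ξ 1 ^ 2 := pow_le_pow_left₀ a0.le (hae.trans (hνM.extremalValue_le x1)) 2
  have hbη : b ^ 2 ≤ η 1 ^ 2 := pow_le_pow_left₀ b0.le (hbe.trans (hωM.extremalValue_le y1)) 2
  refine ⟨?_, ?_, ?_, ?_, ?_⟩
  · refine twoVarShift_commute (exists_abs_alphaWeights_le a hξb)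
      (exists_abs_betaWeights_le b hηb) fun k => ?_
    rw [alphaWeights_of_ne ξ a (k := k + (0, 1)) (by simp [Prod.ext_iff]),
      betaWeights_of_ne η b (k := k + (1, 0)) (by simp [Prod.ext_iff])]
    by_cases hk : k = (0, 0)
    · subst hk
      rw [alphaWeights_zero, betaWeights_zero]
      exact hab.symm
    · rw [alphaWeights_of_ne ξ a hk, betaWeights_of_ne η b hk]
      exact mul_comm _ _
  · exact hνM.isSubnormalOp_alphaWeights hξ_pos hξb a0 hae (hξa.le.trans hae)
  · exact hωM.isSubnormalOp_betaWeights hη_pos hηb b0 hbe (hηb'.le.trans hbe)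
  · refine isHyponormalTuple_alphaWeights_betaWeights hξ_pos hη_pos hξb hηb hξ_mono.monotone
      hη_mono.monotone haξ hbη ?_
    have hbeq : b = a * η 0 / ξ 0 := by rw [hab, mul_div_cancel_right₀ _ x0.ne']
    -- Once `b` is eliminated, the terms in `a ^ 4` cancel and the determinant at the origin is
    -- affine in `a ^ 2`, with sign change at `a = h`.
    have h1 : (ξ 1 ^ 2 - a ^ 2) * (η 1 ^ 2 - b ^ 2) - (ξ 0 * η 0 - a * b) ^ 2 =
        (ξ 0 ^ 2 * (ξ 1 ^ 2 * η 1 ^ 2 - ξ 0 ^ 2 * η 0 ^ 2) -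
          a ^ 2 * (ξ 0 ^ 2 * η 1 ^ 2 + ξ 1 ^ 2 * η 0 ^ 2 - 2 * ξ 0 ^ 2 * η 0 ^ 2)) / ξ 0 ^ 2 := by
      rw [hbeq]
      field_simp
      ring
    rw [← sub_nonneg, h1]
    exact div_nonneg (sub_nonneg.2 hup) (sq_nonneg _)
  · intro hsub
    exact absurd (hsub.le_of_alphaWeights_betaWeights hξ_pos hη_pos hξb hηb hab) hlow.not_ge
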